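/- A cell is a unit square of the square lattice, and a polyomino is a nonempty finite edge-connected set of cells, considered up to translation; its area is its number of cells. A polyomino $P$ is directed if it has a cell, called its origin, from which every cell of $P$ can be reached by a path of north and east unit steps inside $P$; the origin is then the bottom left-hand corner cell. $P$ is column-convex if the cells of each column of $P$ are consecutive. The internal path length of a cell $c$ of a directed column-convex polyomino $P$ is the least number of cells (the origin and $c$ included) on a path inside $P$ from the origin to $c$ that moves between edge-adjacent cells; thus the origin has internal path length $1$. The total internal path length of $P$ is the sum of the internal path lengths of its cells. For an integer $d\ge 0$, a directed column-convex polyomino whose columns have, from left to right, lowest cells at heights $a_1,a_2,\dots,a_k$ is $d$-restricted if $a_{i+1}-a_i\ge d$ for all $2\le i\le k-1$. Let $t_d(n)$ be the sum of the total internal path lengths of all $d$-restricted directed column-convex polyominoes of area $n$, and let $T_d(x)=\sum_{n\ge 0}t_d(n)x^n$. **Corollary.** The generating function, by area, of the total internal path length of all directed column-convex polyominoes is $T_0(x)$, and, as formal power series, $$T_0(x)=\frac{x\left(3x^4-9x^3+8x^2-4x+1\right)}{(1-x)\left(x^2-3x+1\right)^3}.$$ -/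

import Mathlib

namespace Polyomino

/-- The adjacency graph of a finite set `P` of unit cells of the square lattice (a cell is named by
the coordinates of its lower left corner): two cells of `P` are adjacent when they share an edge. -/
def cellGraph (P : Finset (ℤ × ℤ)) : SimpleGraph (ℤ × ℤ) where
  Adj c c' := c ∈ P ∧ c' ∈ P ∧ |c.1 - c'.1| + |c.2 - c'.2| = 1
  symm := ⟨fun c c' h => ⟨h.2.1, h.1, by
    rw [abs_sub_comm c'.1, abs_sub_comm c'.2]; exact h.2.2⟩⟩
  loopless := ⟨fun c h => by simp at h⟩

/-- A polyomino: a nonempty finite edge-connected set of cells. -/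
def IsPolyomino (P : Finset (ℤ × ℤ)) : Prop :=
  P.Nonempty ∧ ∀ c ∈ P, ∀ c' ∈ P, (cellGraph P).Reachable c c'

/-- A north step or an east step between two cells of `P`. -/
def NEStep (P : Finset (ℤ × ℤ)) (c c' : ℤ × ℤ) : Prop :=
  c ∈ P ∧ c' ∈ P ∧ (c' = (c.1, c.2 + 1) ∨ c' = (c.1 + 1, c.2))

/-- `P` is directed, with the cell `(0, 0)` as its bottom left-hand corner cell: every cell of `P`
can be reached from it by north and east steps inside `P`. -/
def IsDirected (P : Finset (ℤ × ℤ)) : Prop :=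
  (0, 0) ∈ P ∧ ∀ c ∈ P, Relation.ReflTransGen (NEStep P) (0, 0) c

/-- Every column of `P` is a contiguous vertical strip. -/
def IsColumnConvex (P : Finset (ℤ × ℤ)) : Prop :=
  ∀ i y₁ y y₂ : ℤ, (i, y₁) ∈ P → (i, y₂) ∈ P → y₁ ≤ y → y ≤ y₂ → (i, y) ∈ P

/-- Directed column-convex polyominoes. Polyominoes are considered up to translation; each
translation class is represented by its member with origin `(0, 0)`. -/
def IsDccp (P : Finset (ℤ × ℤ)) : Prop :=
  IsPolyomino P ∧ IsDirected P ∧ IsColumnConvex P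

/-- `a` is the initial altitude (the height of the lowest cell) of the column of `P` with
abscissa `i`. -/
def IsInitialAltitude (P : Finset (ℤ × ℤ)) (i a : ℤ) : Prop :=
  (i, a) ∈ P ∧ ∀ y, (i, y) ∈ P → a ≤ y

/-- `P` is `d`-restricted: the initial altitude grows by at least `d` from each column to the next,
the first column (the one with abscissa `0`) excepted. This holds trivially if there are at most
two columns. -/
def IsRestricted (d : ℕ) (P : Finset (ℤ × ℤ)) : Prop :=
  ∀ i a a' : ℤ, 1 ≤ i → IsInitialAltitude P i a → IsInitialAltitude P (i + 1) a' →
    (d : ℤ) ≤ a' - a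

/-- The internal path length of a cell: the least number of steps that lead to it through `P` by way
of adjacent cells, where entering the origin `(0, 0)` counts as the first step. -/
noncomputable def ipl (P : Finset (ℤ × ℤ)) (c : ℤ × ℤ) : ℕ :=
  (cellGraph P).dist (0, 0) c + 1

/-- The total internal path length. -/
noncomputable def tipl (P : Finset (ℤ × ℤ)) : ℕ :=
  ∑ c ∈ P, ipl P c

theorem IsDirected.bounds {P : Finset (ℤ × ℤ)} {c : ℤ × ℤ} (h0 : (0, 0) ∈ P)
    (h : Relation.ReflTransGen (NEStep P) (0, 0) c) :
    0 ≤ c.1 ∧ 0 ≤ c.2 ∧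
      Finset.Icc 0 (c.1 + c.2) ⊆ P.image (fun e : ℤ × ℤ => e.1 + e.2) := by
  induction h with
  | refl =>
    refine ⟨le_rfl, le_rfl, fun k hk => ?_⟩
    rw [Finset.mem_Icc] at hk
    exact Finset.mem_image.2 ⟨(0, 0), h0, by simp only at hk ⊢; omega⟩
  | @tail b c _ hbc ih =>
    obtain ⟨h1, h2, h3⟩ := ih
    obtain ⟨_, hc, hs⟩ := hbc
    have hsum : c.1 + c.2 = b.1 + b.2 + 1 ∧ 0 ≤ c.1 ∧ 0 ≤ c.2 := by
      rcases hs with rfl | rfl <;> refine ⟨?_, ?_, ?_⟩ <;> simp only <;> omega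
    refine ⟨hsum.2.1, hsum.2.2, fun k hk => ?_⟩
    rw [Finset.mem_Icc] at hk
    by_cases hk' : k ≤ b.1 + b.2
    · exact h3 (Finset.mem_Icc.2 ⟨hk.1, hk'⟩)
    · exact Finset.mem_image.2 ⟨c, hc, by omega⟩

theorem finite_dccp (n : ℕ) : {P : Finset (ℤ × ℤ) | IsDccp P ∧ P.card = n}.Finite := by
  refine Set.Finite.subset
    (Finset.finite_toSet (Finset.Icc (0 : ℤ) n ×ˢ Finset.Icc (0 : ℤ) n).powerset) ?_
  rintro P ⟨⟨_, ⟨h0, hP⟩, _⟩, hn⟩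
  rw [Finset.mem_coe, Finset.mem_powerset]
  intro c hc
  obtain ⟨h1, h2, h3⟩ := IsDirected.bounds h0 (hP c hc)
  have h4 := (Finset.card_le_card h3).trans Finset.card_image_le
  rw [Int.card_Icc, hn] at h4
  rw [Finset.mem_product, Finset.mem_Icc, Finset.mem_Icc]
  omega

/-- All directed column-convex polyominoes of area `n`. -/
noncomputable def dccps (n : ℕ) : Finset (Finset (ℤ × ℤ)) :=
  (finite_dccp n).toFinset

open scoped Classical in
/-- `t_d(n)`: the sum of the total internal path lengths of all `d`-restricted directed
column-convex polyominoes of area `n`. -/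
noncomputable def restrictedTipl (d n : ℕ) : ℕ :=
  ∑ P ∈ dccps n with IsRestricted d P, tipl P

/-- The generating function `T_d(x) = ∑ t_d(n) x ^ n`. -/
noncomputable def restrictedTiplSeries (d : ℕ) : PowerSeries ℚ :=
  PowerSeries.mk fun n => (restrictedTipl d n : ℚ)

/-- The generating function, by area, of the total internal path length of all directed
column-convex polyominoes. -/
noncomputable def dccpTiplSeries : PowerSeries ℚ :=
  PowerSeries.mk fun n => ((∑ P ∈ dccps n, tipl P : ℕ) : ℚ)

end Polyomino

/-! In a directed polyomino a north-east path from the origin to the cell `(x, y)` has `x + y`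
steps, and no path is shorter, since every step changes `x + y` by at most one. So the internal path
length is `x + y + 1`, independently of the rest of the polyomino. A directed column-convex
polyomino is either a single column or, uniquely, a first column of `h` cells with a smaller such
polyomino `Q` attached at a height `j < h` (`sum_dccps`). Gluing adds `j + 1` to the path length of
each cell of `Q` (`cast_tipl_glue`). Summing over `j` gives, for the area series `F` and the path
length series `T`, the linear equations `F = A + B F` and `T = S + R F + B T + S (x F')`, where `A`,
`B`, `S`, `R` have coefficients `1` (for `n > 0`), `n`, `n(n+1)/2`, `n²(n+1)/2`. Solving them gives
the formula. -/

namespace Polyomino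

/-! ### A local description of directed column-convex polyominoes -/

/-- Every cell lies in the first quadrant, and every cell other than the origin has a western or a
southern neighbour; moreover the columns are contiguous. -/
structure IsLocalDccp (P : Finset (ℤ × ℤ)) : Prop where
  origin_mem : ((0 : ℤ), (0 : ℤ)) ∈ P
  nonneg : ∀ x y : ℤ, (x, y) ∈ P → 0 ≤ x ∧ 0 ≤ y
  pred : ∀ x y : ℤ, (x, y) ∈ P → (x = 0 ∧ y = 0) ∨ (x - 1, y) ∈ P ∨ (x, y - 1) ∈ P
  convex : IsColumnConvex P

theorem NEStep.adj {P : Finset (ℤ × ℤ)} {c c' : ℤ × ℤ} (h : NEStep P c c') :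
    (cellGraph P).Adj c c' := by
  obtain ⟨h1, h2, rfl | rfl⟩ := h
  · exact ⟨h1, h2, by simp⟩
  · exact ⟨h1, h2, by simp⟩

theorem exists_walk_of_reflTransGen {P : Finset (ℤ × ℤ)} {c : ℤ × ℤ}
    (h : Relation.ReflTransGen (NEStep P) (0, 0) c) :
    ∃ w : (cellGraph P).Walk (0, 0) c, (w.length : ℤ) = c.1 + c.2 := by
  induction h with
  | refl => exact ⟨.nil, by simp⟩
  | @tail b c _ hbc ih =>
    obtain ⟨w, hw⟩ := ih
    refine ⟨w.concat hbc.adj, ?_⟩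
    rw [SimpleGraph.Walk.length_concat]
    obtain ⟨_, _, rfl | rfl⟩ := hbc <;> push_cast <;> omega

theorem sub_le_walk_length {P : Finset (ℤ × ℤ)} {c c' : ℤ × ℤ} (w : (cellGraph P).Walk c c') :
    c'.1 + c'.2 - (c.1 + c.2) ≤ w.length := by
  induction w with
  | nil => simp
  | @cons u v _ h _ ih =>
    rw [SimpleGraph.Walk.length_cons]
    have h3 := h.2.2
    have h1 := neg_abs_le (u.1 - v.1)
    have h2 := neg_abs_le (u.2 - v.2)
    push_cast
    omega

theorem IsDirected.ipl_eq {P : Finset (ℤ × ℤ)} (hP : IsDirected P) {c : ℤ × ℤ} (hc : c ∈ P) :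
    (ipl P c : ℤ) = c.1 + c.2 + 1 := by
  obtain ⟨w, hw⟩ := exists_walk_of_reflTransGen (hP.2 c hc)
  have h1 := SimpleGraph.dist_le w
  obtain ⟨w', hw'⟩ := w.reachable.exists_walk_length_eq_dist
  have h2 := sub_le_walk_length w'
  simp only at h2
  rw [ipl]
  push_cast
  omega

theorem IsDirected.isPolyomino {P : Finset (ℤ × ℤ)} (hP : IsDirected P) : IsPolyomino P := by
  have key : ∀ c ∈ P, (cellGraph P).Reachable (0, 0) c := fun c hc =>
    (exists_walk_of_reflTransGen (hP.2 c hc)).choose.reachable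
  exact ⟨⟨_, hP.1⟩, fun c hc c' hc' => (key c hc).symm.trans (key c' hc')⟩

theorem IsDccp.isLocalDccp {P : Finset (ℤ × ℤ)} (hP : IsDccp P) : IsLocalDccp P where
  origin_mem := hP.2.1.1
  nonneg x y h :=
    have hb := IsDirected.bounds hP.2.1.1 (hP.2.1.2 _ h)
    ⟨hb.1, hb.2.1⟩
  pred x y h := by
    rcases (hP.2.1.2 _ h).cases_tail with h0 | ⟨⟨u, v⟩, _, hb, _, hs⟩
    · left; simpa using h0
    · simp only [Prod.mk.injEq] at hs
      rcases hs with ⟨rfl, rfl⟩ | ⟨rfl, rfl⟩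
      · right; right; simpa using hb
      · right; left; simpa using hb
  convex := hP.2.2

/-- Induction on the antidiagonal: a western or southern neighbour lies on the previous one. -/
theorem IsLocalDccp.reflTransGen {P : Finset (ℤ × ℤ)} (hP : IsLocalDccp P) (n : ℕ) :
    ∀ x y : ℤ, (x, y) ∈ P → x + y = n → Relation.ReflTransGen (NEStep P) (0, 0) (x, y) := by
  induction n with
  | zero =>
    intro x y h hn
    have := hP.nonneg x y h
    obtain rfl : x = 0 := by push_cast at hn; omega
    obtain rfl : y = 0 := by push_cast at hn; omega
    exact .refl
  | succ n ih =>
    intro x y h hn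
    push_cast at hn
    rcases hP.pred x y h with h0 | h1 | h1
    · omega
    · exact (ih _ _ h1 (by omega)).tail ⟨h1, h, Or.inr (by simp)⟩
    · exact (ih _ _ h1 (by omega)).tail ⟨h1, h, Or.inl (by simp)⟩

theorem IsLocalDccp.isDccp {P : Finset (ℤ × ℤ)} (hP : IsLocalDccp P) : IsDccp P := by
  have hd : IsDirected P := ⟨hP.origin_mem, fun c hc => by
    have h := hP.nonneg c.1 c.2 hc
    exact hP.reflTransGen (c.1 + c.2).toNat c.1 c.2 hc (by omega)⟩
  exact ⟨hd.isPolyomino, hd, hP.convex⟩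

theorem mem_dccps {n : ℕ} {P : Finset (ℤ × ℤ)} : P ∈ dccps n ↔ IsLocalDccp P ∧ P.card = n := by
  rw [dccps, Set.Finite.mem_toFinset]
  exact and_congr_left fun _ => ⟨IsDccp.isLocalDccp, IsLocalDccp.isDccp⟩

theorem IsLocalDccp.tipl_eq {P : Finset (ℤ × ℤ)} (hP : IsLocalDccp P) :
    (tipl P : ℤ) = ∑ c ∈ P, (c.1 + c.2 + 1) := by
  rw [tipl]
  push_cast
  exact Finset.sum_congr rfl fun c hc => hP.isDccp.2.1.ipl_eq hc

/-- The initial altitudes of a directed column-convex polyomino grow weakly. -/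
theorem IsLocalDccp.isRestricted_zero {P : Finset (ℤ × ℤ)} (hP : IsLocalDccp P) :
    IsRestricted 0 P := by
  intro i a a' hi ha ha'
  -- The lowest cell of column `i + 1` is not the origin and has no cell below it, so its western
  -- neighbour is a cell of column `i`.
  rcases hP.pred _ _ ha'.1 with h | h | h
  · omega
  · have := ha.2 a' (by simpa using h)
    push_cast
    omega
  · have := ha'.2 _ h
    omega

/-! ### Splitting off the first column -/

/-- The first column, consisting of `h` cells. -/
def firstColumn (h : ℕ) : Finset (ℤ × ℤ) :=
  (Finset.range h).image fun k : ℕ => ((0 : ℤ), (k : ℤ))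

/-- The set `Q` moved by one unit to the east and by `j` units to the north. -/
def shift (j : ℕ) (Q : Finset (ℤ × ℤ)) : Finset (ℤ × ℤ) :=
  Q.image fun c => (c.1 + 1, c.2 + (j : ℤ))

/-- A first column of height `h`, to the right of which `Q` is attached at height `j`. -/
def glue (h j : ℕ) (Q : Finset (ℤ × ℤ)) : Finset (ℤ × ℤ) :=
  firstColumn h ∪ shift j Q

theorem mem_firstColumn {h : ℕ} {x y : ℤ} :
    (x, y) ∈ firstColumn h ↔ x = 0 ∧ 0 ≤ y ∧ y < h := by
  simp only [firstColumn, Finset.mem_image, Finset.mem_range, Prod.mk.injEq]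
  constructor
  · rintro ⟨k, hk, rfl, rfl⟩
    omega
  · rintro ⟨rfl, h0, h1⟩
    exact ⟨y.toNat, by omega, rfl, by omega⟩

theorem mem_shift {j : ℕ} {Q : Finset (ℤ × ℤ)} {x y : ℤ} :
    (x, y) ∈ shift j Q ↔ (x - 1, y - j) ∈ Q := by
  simp only [shift, Finset.mem_image, Prod.mk.injEq, Prod.exists]
  constructor
  · rintro ⟨a, b, hab, rfl, rfl⟩
    simpa using hab
  · exact fun h => ⟨_, _, h, by ring, by ring⟩

theorem mem_glue {h j : ℕ} {Q : Finset (ℤ × ℤ)} {x y : ℤ} :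
    (x, y) ∈ glue h j Q ↔ (x = 0 ∧ 0 ≤ y ∧ y < h) ∨ (x - 1, y - j) ∈ Q := by
  rw [glue, Finset.mem_union, mem_firstColumn, mem_shift]

theorem firstColumn_injective :
    Function.Injective fun k : ℕ => ((0 : ℤ), (k : ℤ)) :=
  fun a b hab => by simpa using hab

theorem shift_injective (j : ℕ) :
    Function.Injective fun c : ℤ × ℤ => (c.1 + 1, c.2 + (j : ℤ)) :=
  fun a b hab => by
    simp only [Prod.mk.injEq, add_left_inj] at hab
    exact Prod.ext hab.1 hab.2

theorem card_firstColumn (h : ℕ) : (firstColumn h).card = h := by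
  rw [firstColumn, Finset.card_image_of_injective _ firstColumn_injective, Finset.card_range]

theorem IsLocalDccp.disjoint {Q : Finset (ℤ × ℤ)} (hQ : IsLocalDccp Q) (h j : ℕ) :
    Disjoint (firstColumn h) (shift j Q) := by
  rw [Finset.disjoint_left]
  rintro ⟨x, y⟩ h1 h2
  rw [mem_firstColumn] at h1
  have := hQ.nonneg _ _ (mem_shift.1 h2)
  omega

theorem IsLocalDccp.card_glue {Q : Finset (ℤ × ℤ)} (hQ : IsLocalDccp Q) (h j : ℕ) :
    (glue h j Q).card = h + Q.card := by
  rw [glue, Finset.card_union_of_disjoint (hQ.disjoint h j), card_firstColumn, shift,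
    Finset.card_image_of_injective _ (shift_injective j)]

theorem isLocalDccp_firstColumn {h : ℕ} (hh : 0 < h) : IsLocalDccp (firstColumn h) where
  origin_mem := by rw [mem_firstColumn]; omega
  nonneg x y hc := by rw [mem_firstColumn] at hc; omega
  pred x y hc := by simp only [mem_firstColumn] at hc ⊢; omega
  convex x y₁ y y₂ := by simp only [mem_firstColumn]; omega

theorem IsLocalDccp.glue {Q : Finset (ℤ × ℤ)} (hQ : IsLocalDccp Q) {h j : ℕ} (hj : j < h) :
    IsLocalDccp (glue h j Q) where
  origin_mem := by rw [mem_glue]; omega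
  nonneg x y hc := by
    rw [mem_glue] at hc
    rcases hc with hc | hc
    · omega
    · have := hQ.nonneg _ _ hc
      omega
  pred x y hc := by
    simp only [mem_glue] at hc ⊢
    rcases hc with hc | hc
    · omega
    · rcases hQ.pred _ _ hc with h0 | h0 | h0
      · omega
      · exact Or.inr (Or.inl (Or.inr h0))
      · refine Or.inr (Or.inr (Or.inr ?_))
        rwa [show y - 1 - (j : ℤ) = y - j - 1 by ring]
  convex x y₁ y y₂ h1 h2 h3 h4 := by
    rw [mem_glue] at h1 h2 ⊢
    rcases h1 with h1 | h1 <;> rcases h2 with h2 | h2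
    · omega
    · have := hQ.nonneg _ _ h2
      omega
    · have := hQ.nonneg _ _ h1
      omega
    · exact Or.inr (hQ.convex _ _ _ _ h1 h2 (by omega) (by omega))

theorem glue_ne_firstColumn {Q : Finset (ℤ × ℤ)} (hQ : IsLocalDccp Q) (h j n : ℕ) :
    glue h j Q ≠ firstColumn n := by
  intro he
  have h1 : ((1 : ℤ), (j : ℤ)) ∈ glue h j Q := by
    rw [mem_glue]
    right
    simpa using hQ.origin_mem
  rw [he, mem_firstColumn] at h1
  omega

theorem height_le_of_glue_eq {Q Q' : Finset (ℤ × ℤ)} (hQ' : IsLocalDccp Q') {h j h' j' : ℕ}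
    (he : glue h j Q = glue h' j' Q') : h ≤ h' := by
  by_contra hlt
  have h1 : ((0 : ℤ), (h' : ℤ)) ∈ glue h j Q := by rw [mem_glue]; omega
  rw [he, mem_glue] at h1
  rcases h1 with h1 | h1
  · omega
  · have := hQ'.nonneg _ _ h1
    omega

/-- The cell `(1, j)` is the image of the origin of `Q`, and every cell of the shifted `Q'` has
height at least `j'`. -/
theorem altitude_le_of_glue_eq {Q Q' : Finset (ℤ × ℤ)} (hQ : IsLocalDccp Q)
    (hQ' : IsLocalDccp Q') {h j h' j' : ℕ} (he : glue h j Q = glue h' j' Q') : j' ≤ j := by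
  have h1 : ((1 : ℤ), (j : ℤ)) ∈ glue h j Q := by
    rw [mem_glue]
    right
    simpa using hQ.origin_mem
  rw [he, mem_glue] at h1
  rcases h1 with h1 | h1
  · omega
  · have := hQ'.nonneg _ _ h1
    omega

theorem glue_inj {Q Q' : Finset (ℤ × ℤ)} (hQ : IsLocalDccp Q) (hQ' : IsLocalDccp Q')
    {h j h' j' : ℕ} (he : glue h j Q = glue h' j' Q') : h = h' ∧ j = j' ∧ Q = Q' := by
  obtain rfl := le_antisymm (height_le_of_glue_eq hQ' he) (height_le_of_glue_eq hQ he.symm)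
  obtain rfl := le_antisymm (altitude_le_of_glue_eq hQ' hQ he.symm)
    (altitude_le_of_glue_eq hQ hQ' he)
  refine ⟨rfl, rfl, ?_⟩
  ext ⟨x, y⟩
  have key : ((x + 1, y + j) ∈ glue h j Q) ↔ ((x + 1, y + j) ∈ glue h j Q') := by rw [he]
  simp only [mem_glue, add_sub_cancel_right] at key
  constructor
  · intro hc
    have := hQ.nonneg _ _ hc
    rcases key.1 (Or.inr hc) with h1 | h1
    · omega
    · exact h1
  · intro hc
    have := hQ'.nonneg _ _ hc
    rcases key.2 (Or.inr hc) with h1 | h1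
    · omega
    · exact h1

theorem IsLocalDccp.exists_height {P : Finset (ℤ × ℤ)} (hP : IsLocalDccp P) :
    ∃ h : ℕ, ∀ y : ℤ, (0, y) ∈ P ↔ 0 ≤ y ∧ y < h := by
  obtain ⟨⟨u, M⟩, hM, hmax⟩ := Finset.exists_max_image (P.filter fun c => c.1 = 0) (fun c => c.2)
    ⟨(0, 0), by simp [hP.origin_mem]⟩
  simp only [Finset.mem_filter, and_imp, Prod.forall] at hM hmax
  obtain ⟨hM, rfl⟩ := hM
  have h0 := hP.nonneg _ _ hM
  refine ⟨(M + 1).toNat, fun y => ⟨fun hy => ?_, fun hy => ?_⟩⟩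
  · have := hmax _ _ hy rfl
    have := hP.nonneg _ _ hy
    omega
  · exact hP.convex _ _ _ _ hP.origin_mem hM hy.1 (by omega)

/-- Take the leftmost of the lowest cells outside the first column. It has no southern neighbour,
hence a western one, which by leftmostness lies in the first column. -/
theorem IsLocalDccp.exists_altitude {P : Finset (ℤ × ℤ)} (hP : IsLocalDccp P) {c : ℤ × ℤ}
    (hc : c ∈ P) (hc1 : 1 ≤ c.1) :
    ∃ j : ℕ, (0, (j : ℤ)) ∈ P ∧ (1, (j : ℤ)) ∈ P ∧ ∀ x y : ℤ, (x, y) ∈ P → 1 ≤ x → j ≤ y := by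
  obtain ⟨⟨u, v⟩, huv, hmin⟩ := Finset.exists_min_image (P.filter fun c => 1 ≤ c.1) (fun c => c.2)
    ⟨c, by simp [hc, hc1]⟩
  simp only [Finset.mem_filter, and_imp, Prod.forall] at huv hmin
  obtain ⟨⟨s, t⟩, hst, hmin'⟩ := Finset.exists_min_image
    (P.filter fun c => 1 ≤ c.1 ∧ c.2 = v) (fun c => c.1) ⟨(u, v), by simp [huv]⟩
  simp only [Finset.mem_filter, and_imp, Prod.forall] at hst hmin'
  obtain ⟨hst, hs, rfl⟩ := hst
  have h0 := hP.nonneg _ _ hst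
  rcases hP.pred _ _ hst with h1 | h1 | h1
  · omega
  · obtain rfl : s = 1 := by
      by_contra hne
      have := hmin' _ _ h1 (by omega) rfl
      omega
    refine ⟨t.toNat, ?_⟩
    rw [Int.toNat_of_nonneg h0.2]
    exact ⟨h1, hst, hmin⟩
  · have := hmin _ _ h1 hs
    omega

theorem IsLocalDccp.eq_firstColumn_or_glue {P : Finset (ℤ × ℤ)} (hP : IsLocalDccp P) :
    P = firstColumn P.card ∨
      ∃ h j : ℕ, ∃ Q, j < h ∧ IsLocalDccp Q ∧ P = Polyomino.glue h j Q := by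
  obtain ⟨h, hh⟩ := hP.exists_height
  by_cases hc : ∃ c ∈ P, 1 ≤ c.1
  · right
    obtain ⟨c, hc, hc1⟩ := hc
    obtain ⟨j, hj0, hj1, hj⟩ := hP.exists_altitude hc hc1
    have hjh := (hh j).1 hj0
    let Q := (P.filter fun c => 1 ≤ c.1).image fun c => (c.1 - 1, c.2 - (j : ℤ))
    have hQ : ∀ x y : ℤ, (x, y) ∈ Q ↔ 0 ≤ x ∧ (x + 1, y + j) ∈ P := by
      intro x y
      simp only [Q, Finset.mem_image, Finset.mem_filter, Prod.mk.injEq, Prod.exists]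
      constructor
      · rintro ⟨a, b, ⟨hab, ha⟩, rfl, rfl⟩
        exact ⟨by omega, by simpa using hab⟩
      · exact fun hx => ⟨_, _, ⟨hx.2, by omega⟩, by ring, by ring⟩
    refine ⟨h, j, Q, by omega, ⟨?_, ?_, ?_, ?_⟩, ?_⟩
    · rw [hQ]
      simpa using hj1
    · intro x y hxy
      rw [hQ] at hxy
      have := hj _ _ hxy.2 (by omega)
      omega
    · intro x y hxy
      simp only [hQ] at hxy ⊢
      obtain ⟨hx, hxy⟩ := hxy
      have hy := hj _ _ hxy (by omega)
      rcases hP.pred _ _ hxy with h1 | h1 | h1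
      · omega
      -- In the first column of `Q` the western neighbour is cut off; convexity, applied with the
      -- lowest cell `(1, j)`, supplies a southern one instead.
      · by_cases hx0 : x = 0
        · subst hx0
          by_cases hy0 : y = 0
          · exact Or.inl ⟨rfl, hy0⟩
          · exact Or.inr (Or.inr ⟨le_rfl, hP.convex _ _ _ _ hj1 hxy (by omega) (by omega)⟩)
        · refine Or.inr (Or.inl ⟨by omega, ?_⟩)
          rwa [show x - 1 + 1 = x + 1 - 1 by ring]
      · refine Or.inr (Or.inr ⟨hx, ?_⟩)
        rwa [show y - 1 + (j : ℤ) = y + j - 1 by ring]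
    · intro x y₁ y y₂ h1 h2 h3 h4
      rw [hQ] at h1 h2 ⊢
      exact ⟨h1.1, hP.convex _ _ _ _ h1.2 h2.2 (by omega) (by omega)⟩
    · ext ⟨x, y⟩
      rw [mem_glue, hQ, sub_add_cancel, sub_add_cancel]
      constructor
      · intro hxy
        have := hP.nonneg _ _ hxy
        by_cases hx : x = 0
        · subst hx
          exact Or.inl ⟨rfl, (hh y).1 hxy⟩
        · exact Or.inr ⟨by omega, hxy⟩
      · rintro (⟨rfl, h1⟩ | h1)
        · exact (hh y).2 h1
        · exact h1.2
  · left
    push Not at hc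
    have he : P = firstColumn h := by
      ext ⟨x, y⟩
      rw [mem_firstColumn, ← hh]
      constructor
      · intro hxy
        have := hP.nonneg _ _ hxy
        have := hc _ hxy
        obtain rfl : x = 0 := by simp only at this; omega
        exact ⟨rfl, hxy⟩
      · rintro ⟨rfl, h1⟩
        exact h1
    have hcard : P.card = h := by rw [he, card_firstColumn]
    rw [hcard, ← he]

/-! ### Recurrences -/

/-- Settles the constant coefficients, as the recurrences assume `0 < n`. -/
theorem dccps_zero : dccps 0 = ∅ := by
  rw [Finset.eq_empty_iff_forall_notMem]
  intro P hP
  rw [mem_dccps, Finset.card_eq_zero] at hP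
  obtain ⟨hP, rfl⟩ := hP
  exact absurd hP.origin_mem (Finset.notMem_empty _)

/-- The gluing data that yield the polyominoes of area `n` with at least two columns. -/
noncomputable def gluings (n : ℕ) : Finset ((_ : ℕ × ℕ) × ℕ × Finset (ℤ × ℤ)) :=
  (Finset.HasAntidiagonal.antidiagonal n).sigma fun p => Finset.range p.1 ×ˢ dccps p.2

theorem mem_gluings {n h m j : ℕ} {Q : Finset (ℤ × ℤ)} :
    (⟨(h, m), j, Q⟩ : (_ : ℕ × ℕ) × ℕ × Finset (ℤ × ℤ)) ∈ gluings n ↔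
      h + m = n ∧ j < h ∧ IsLocalDccp Q ∧ Q.card = m := by
  simp [gluings, mem_dccps]

theorem dccps_eq_insert {n : ℕ} (hn : 0 < n) :
    dccps n = insert (firstColumn n) ((gluings n).image fun s => glue s.1.1 s.2.1 s.2.2) := by
  ext P
  rw [Finset.mem_insert, Finset.mem_image, mem_dccps]
  constructor
  · rintro ⟨hP, rfl⟩
    refine hP.eq_firstColumn_or_glue.imp_right ?_
    rintro ⟨h, j, Q, hj, hQ, rfl⟩
    exact ⟨⟨(h, Q.card), j, Q⟩, mem_gluings.2 ⟨(hQ.card_glue h j).symm, hj, hQ, rfl⟩, rfl⟩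
  · rintro (rfl | ⟨⟨⟨h, m⟩, j, Q⟩, hs, rfl⟩)
    · exact ⟨isLocalDccp_firstColumn hn, card_firstColumn n⟩
    · obtain ⟨rfl, hj, hQ, rfl⟩ := mem_gluings.1 hs
      exact ⟨hQ.glue hj, hQ.card_glue h j⟩

/-- Summation over the polyominoes of area `n` by splitting off the first column. -/
theorem sum_dccps {M : Type*} [AddCommMonoid M] {n : ℕ} (hn : 0 < n)
    (g : Finset (ℤ × ℤ) → M) :
    ∑ P ∈ dccps n, g P = g (firstColumn n) +
      ∑ p ∈ Finset.HasAntidiagonal.antidiagonal n,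
        ∑ j ∈ Finset.range p.1, ∑ Q ∈ dccps p.2, g (glue p.1 j Q) := by
  rw [dccps_eq_insert hn, Finset.sum_insert, Finset.sum_image, gluings, Finset.sum_sigma]
  · simp only [Finset.sum_product]
  · rintro ⟨⟨h, m⟩, j, Q⟩ hs ⟨⟨h', m'⟩, j', Q'⟩ hs' he
    obtain ⟨-, -, hQ, rfl⟩ := mem_gluings.1 hs
    obtain ⟨-, -, hQ', rfl⟩ := mem_gluings.1 hs'
    obtain ⟨rfl, rfl, rfl⟩ := glue_inj hQ hQ' he
    rfl
  · rw [Finset.mem_image]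
    rintro ⟨⟨⟨h, m⟩, j, Q⟩, hs, he⟩
    exact glue_ne_firstColumn (mem_gluings.1 hs).2.2.1 h j n he

theorem sum_range_cast_add_one (h : ℕ) :
    ∑ k ∈ Finset.range h, ((k : ℚ) + 1) = h * (h + 1) / 2 := by
  induction h with
  | zero => simp
  | succ h ih => rw [Finset.sum_range_succ, ih]; push_cast; ring

theorem IsLocalDccp.cast_tipl {P : Finset (ℤ × ℤ)} (hP : IsLocalDccp P) :
    (tipl P : ℚ) = ∑ c ∈ P, ((c.1 : ℚ) + c.2 + 1) := by
  exact_mod_cast congrArg (Int.cast : ℤ → ℚ) hP.tipl_eq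

theorem sum_firstColumn (h : ℕ) :
    ∑ c ∈ firstColumn h, ((c.1 : ℚ) + c.2 + 1) = h * (h + 1) / 2 := by
  rw [firstColumn, Finset.sum_image firstColumn_injective.injOn, ← sum_range_cast_add_one]
  simp

theorem cast_tipl_firstColumn {h : ℕ} (hh : 0 < h) :
    (tipl (firstColumn h) : ℚ) = h * (h + 1) / 2 := by
  rw [(isLocalDccp_firstColumn hh).cast_tipl, sum_firstColumn]

theorem IsLocalDccp.cast_tipl_glue {Q : Finset (ℤ × ℤ)} (hQ : IsLocalDccp Q) {h j : ℕ}
    (hj : j < h) :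
    (tipl (Polyomino.glue h j Q) : ℚ) = h * (h + 1) / 2 + tipl Q + (j + 1) * Q.card := by
  rw [(hQ.glue hj).cast_tipl, hQ.cast_tipl, Polyomino.glue,
    Finset.sum_union (hQ.disjoint h j), sum_firstColumn, shift,
    Finset.sum_image (shift_injective j).injOn, add_assoc, mul_comm ((j : ℚ) + 1),
    ← nsmul_eq_mul Q.card, ← Finset.sum_const, ← Finset.sum_add_distrib]
  congr 1
  refine Finset.sum_congr rfl fun c _ => ?_
  push_cast
  ring

theorem card_dccps {n : ℕ} (hn : 0 < n) :
    ((dccps n).card : ℚ) =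
      1 + ∑ p ∈ Finset.HasAntidiagonal.antidiagonal n, (p.1 : ℚ) * (dccps p.2).card := by
  have h := sum_dccps hn fun _ => (1 : ℚ)
  simpa using h

/-- For each `Q` there are `p.1` heights `j`, and the shifts `j + 1` add up to `p.1 (p.1 + 1) / 2`.
-/
theorem sum_tipl_dccps {n : ℕ} (hn : 0 < n) :
    ∑ P ∈ dccps n, (tipl P : ℚ) = (n : ℚ) * (n + 1) / 2 +
      ∑ p ∈ Finset.HasAntidiagonal.antidiagonal n,
        (((p.1 : ℚ) ^ 2 * (p.1 + 1) / 2) * (dccps p.2).card +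
          (p.1 : ℚ) * ∑ Q ∈ dccps p.2, (tipl Q : ℚ) +
          ((p.1 : ℚ) * (p.1 + 1) / 2) * (p.2 * (dccps p.2).card)) := by
  rw [sum_dccps hn fun P => (tipl P : ℚ), cast_tipl_firstColumn hn]
  congr 1
  refine Finset.sum_congr rfl fun p _ => ?_
  have key : ∀ j ∈ Finset.range p.1, ∑ Q ∈ dccps p.2, (tipl (glue p.1 j Q) : ℚ) =
      ((p.1 : ℚ) * (p.1 + 1) / 2) * (dccps p.2).card + ∑ Q ∈ dccps p.2, (tipl Q : ℚ) +
        ((j : ℚ) + 1) * (p.2 * (dccps p.2).card) := by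
    intro j hj
    have hQ : ∀ Q ∈ dccps p.2, (tipl (glue p.1 j Q) : ℚ) =
        (p.1 : ℚ) * (p.1 + 1) / 2 + tipl Q + ((j : ℚ) + 1) * p.2 := by
      intro Q hQ
      obtain ⟨hQ, hm⟩ := mem_dccps.1 hQ
      rw [hQ.cast_tipl_glue (Finset.mem_range.1 hj), hm]
    rw [Finset.sum_congr rfl hQ, Finset.sum_add_distrib, Finset.sum_add_distrib,
      Finset.sum_const, Finset.sum_const, nsmul_eq_mul, nsmul_eq_mul]
    ring
  rw [Finset.sum_congr rfl key, Finset.sum_add_distrib, ← Finset.sum_mul,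
    sum_range_cast_add_one, Finset.sum_const, Finset.card_range, nsmul_eq_mul]
  ring

/-! ### Generating functions -/

open PowerSeries

/-- Multiplication by `1 - X` is the backward difference, which lowers the degree of a polynomial
coefficient sequence. -/
theorem mk_mul_one_sub_X {a b : ℕ → ℚ} (h0 : a 0 = b 0) (h : ∀ n, a (n + 1) - a n = b (n + 1)) :
    mk a * (1 - X) = mk b := by
  ext n
  rw [mul_sub, mul_one, map_sub]
  cases n with
  | zero => simp [h0]
  | succ n => rw [coeff_succ_mul_X, coeff_mk, coeff_mk, coeff_mk, h]

/-- The generating function by area of directed column-convex polyominoes. -/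
noncomputable def dccpSeries : PowerSeries ℚ :=
  mk fun n => ((dccps n).card : ℚ)

theorem mk_ite_mul_one_sub_X : (mk fun n => if n = 0 then 0 else 1 : ℚ⟦X⟧) * (1 - X) = X := by
  rw [mk_mul_one_sub_X (b := fun n => if n = 1 then 1 else 0)]
  · ext n
    simp [coeff_X]
  · simp
  · intro n
    cases n <;> simp

theorem mk_cast_mul_one_sub_X :
    (mk fun n => (n : ℚ)) * (1 - X) = mk fun n => if n = 0 then 0 else 1 :=
  mk_mul_one_sub_X (by simp) (by simp)

theorem mk_triangle_mul_one_sub_X :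
    (mk fun n => (n : ℚ) * (n + 1) / 2) * (1 - X) = mk fun n => (n : ℚ) :=
  mk_mul_one_sub_X (by simp) (fun n => by push_cast; ring)

theorem mk_pyramid_mul_one_sub_X :
    (mk fun n => (n : ℚ) ^ 2 * (n + 1) / 2) * (1 - X) =
      3 * (mk fun n => (n : ℚ) * (n + 1) / 2) - 2 * mk fun n => (n : ℚ) := by
  rw [mk_mul_one_sub_X (b := fun n => 3 * ((n : ℚ) * (n + 1) / 2) - 2 * n)]
  · ext n
    rw [map_sub, ← map_ofNat (C (R := ℚ)) 3, ← map_ofNat (C (R := ℚ)) 2, coeff_C_mul, coeff_C_mul]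
    simp
  · simp
  · intro n
    push_cast
    ring

theorem dccpSeries_eq :
    dccpSeries = (mk fun n => if n = 0 then 0 else 1) + (mk fun n => (n : ℚ)) * dccpSeries := by
  ext n
  rw [map_add, coeff_mul]
  simp only [dccpSeries, coeff_mk]
  rcases Nat.eq_zero_or_pos n with rfl | hn
  · simp [dccps_zero]
  · rw [if_neg hn.ne', card_dccps hn]

theorem X_mul_derivative_dccpSeries :
    X * d⁄dX ℚ dccpSeries = mk fun n => (n : ℚ) * (dccps n).card := by
  ext n
  cases n with
  | zero => simp
  | succ n =>
    rw [coeff_succ_X_mul, coeff_derivative, dccpSeries, coeff_mk, coeff_mk]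
    push_cast
    ring

theorem dccpTiplSeries_eq :
    dccpTiplSeries = (mk fun n => (n : ℚ) * (n + 1) / 2) +
      ((mk fun n => (n : ℚ) ^ 2 * (n + 1) / 2) * dccpSeries +
        (mk fun n => (n : ℚ)) * dccpTiplSeries +
        (mk fun n => (n : ℚ) * (n + 1) / 2) * (X * d⁄dX ℚ dccpSeries)) := by
  rw [X_mul_derivative_dccpSeries]
  ext n
  simp only [map_add, coeff_mul, dccpTiplSeries, dccpSeries, coeff_mk, Nat.cast_sum,
    ← Finset.sum_add_distrib]
  rcases Nat.eq_zero_or_pos n with rfl | hn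
  · simp [dccps_zero]
  · exact sum_tipl_dccps hn

theorem one_sub_X_ne_zero : (1 - X : ℚ⟦X⟧) ≠ 0 := fun h => by
  simpa using congrArg constantCoeff h

theorem dccpSeries_mul : dccpSeries * (X ^ 2 - 3 * X + 1) = X * (1 - X) := by
  have h0 := mk_ite_mul_one_sub_X
  have h1 := mk_cast_mul_one_sub_X
  have hF := dccpSeries_eq
  -- With the series as atoms, what remains is commutative algebra: `B * (1 - X) ^ 2 = X`, and `(1 -
  -- X) ^ 2 - X` is the quadratic.
  generalize (mk fun n => if n = 0 then 0 else 1 : ℚ⟦X⟧) = A at *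
  generalize (mk fun n => (n : ℚ)) = B at *
  linear_combination (1 - X) ^ 2 * hF + (1 - X + dccpSeries) * h0 + (1 - X) * dccpSeries * h1

/-- Differentiate the product in `dccpSeries_mul`, multiply by the quadratic and eliminate
`dccpSeries` with the same equation. -/
theorem derivative_dccpSeries_mul :
    d⁄dX ℚ dccpSeries * (X ^ 2 - 3 * X + 1) ^ 2 = 1 - 2 * X + 2 * X ^ 2 := by
  have h := congrArg (d⁄dX ℚ) dccpSeries_mul
  have h3 : d⁄dX ℚ (3 : ℚ⟦X⟧) = 0 := by
    rw [← map_ofNat (C (R := ℚ)) 3, derivative_C]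
  simp only [Derivation.leibniz, Derivation.leibniz_pow, map_add, map_sub, derivative_X, h3,
    Derivation.map_one_eq_zero, smul_eq_mul, nsmul_eq_mul] at h
  push_cast at h
  linear_combination (X ^ 2 - 3 * X + 1) * h + (3 - 2 * X) * dccpSeries_mul

theorem dccpTiplSeries_mul :
    dccpTiplSeries * ((1 - X) * (X ^ 2 - 3 * X + 1) ^ 3) =
      X * (3 * X ^ 4 - 9 * X ^ 3 + 8 * X ^ 2 - 4 * X + 1) := by
  have h0 := mk_ite_mul_one_sub_X
  have h1 := mk_cast_mul_one_sub_X
  have h2 := mk_triangle_mul_one_sub_X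
  have h3 := mk_pyramid_mul_one_sub_X
  have hT := dccpTiplSeries_eq
  have hF := dccpSeries_mul
  have hD := derivative_dccpSeries_mul
  generalize (mk fun n => if n = 0 then 0 else 1 : ℚ⟦X⟧) = A at *
  generalize (mk fun n => (n : ℚ)) = B at *
  generalize (mk fun n => (n : ℚ) * (n + 1) / 2) = S at *
  generalize (mk fun n => (n : ℚ) ^ 2 * (n + 1) / 2) = R at *
  generalize dccpTiplSeries = T at *
  generalize d⁄dX ℚ dccpSeries = F' at *
  generalize dccpSeries = F at *
  have hB : B * (1 - X) ^ 2 = X := by linear_combination (1 - X) * h1 + h0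
  have hS : S * (1 - X) ^ 3 = X := by linear_combination (1 - X) ^ 2 * h2 + hB
  have hR : R * (1 - X) ^ 4 = X * (1 + 2 * X) := by
    linear_combination (1 - X) ^ 3 * h3 + 3 * hS - 2 * (1 - X) * hB
  -- Clearing the denominators of `S`, `R` and `B` costs `(1 - X) ^ 4`, three factors more than the
  -- goal has.
  refine mul_right_cancel₀ (pow_ne_zero 3 one_sub_X_ne_zero) ?_
  have hT' : T * (X ^ 2 - 3 * X + 1) * (1 - X) ^ 2 =
      X * (1 - X) + X * (1 + 2 * X) * F + X * (1 - X) * (X * F') := by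
    linear_combination (1 - X) ^ 4 * hT + (1 - X) * (1 + X * F') * hS + F * hR +
      (1 - X) ^ 2 * T * hB
  linear_combination (1 - X) ^ 2 * (X ^ 2 - 3 * X + 1) ^ 2 * hT' +
    (1 - X) ^ 2 * (X * (1 + 2 * X)) * (X ^ 2 - 3 * X + 1) * hF +
    (1 - X) ^ 2 * (X * (1 - X) * X) * hD

open scoped Classical in
theorem dccpTiplSeries_eq_restrictedTiplSeries : dccpTiplSeries = restrictedTiplSeries 0 := by
  ext n
  rw [dccpTiplSeries, restrictedTiplSeries, coeff_mk, coeff_mk, restrictedTipl,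
    Finset.filter_true_of_mem]
  exact fun P hP => (mem_dccps.1 hP).1.isRestricted_zero

end Polyomino

theorem mainTheorem6 :
    Polyomino.dccpTiplSeries = Polyomino.restrictedTiplSeries 0 ∧
      Polyomino.restrictedTiplSeries 0 =
        (PowerSeries.X * (3 * PowerSeries.X ^ 4 - 9 * PowerSeries.X ^ 3 + 8 * PowerSeries.X ^ 2
            - 4 * PowerSeries.X + 1)) *
          ((1 - PowerSeries.X) *
            (PowerSeries.X ^ 2 - 3 * PowerSeries.X + 1) ^ 3 : PowerSeries ℚ)⁻¹ := by
  refine ⟨Polyomino.dccpTiplSeries_eq_restrictedTiplSeries, ?_⟩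
  rw [← Polyomino.dccpTiplSeries_eq_restrictedTiplSeries, PowerSeries.eq_mul_inv_iff_mul_eq]
  · exact Polyomino.dccpTiplSeries_mul
  -- The denominator has constant coefficient `1`, so `⁻¹` is a genuine inverse and not the default
  -- value `0`.
  · simp
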